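/- Let $C$ and $D$ be two disjoint circles of positive radius in the Euclidean plane, and let $N \ge 3$. The bicentric (Poncelet) family of $N$-gons of the pair consists of all closed polygons $p_1,\dots,p_N$ (indices modulo $N$) whose vertices lie on $C$, whose sidelines $p_jp_{j+1}$ (the sides or their extensions) are tangent to $D$, and which satisfy $p_j \ne p_{j+1}$ and $p_{j-1} \ne p_{j+1}$ for all $j$. Let $\ell$ be a limiting point of the pair, that is, a point such that an inversion centred at $\ell$ sends $C$ and $D$ to two concentric circles. For a polygon of the family let $q_j$ be the orthogonal projection of $\ell$ onto the line $p_jp_{j+1}$; the polygon $q_1,\dots,q_N$ is the pedal polygon with respect to $\ell$. Then the perimeter $\sum_{j=1}^{N} |q_{j+1}-q_j|$ is the same for all polygons of the family (it depends only on $C$, $D$, $N$ and $\ell$). In particular this holds for each of the two limiting points of a non-concentric pair. -/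

import Mathlib

/-- The Euclidean plane. -/
abbrev Plane : Type := EuclideanSpace ℝ (Fin 2)

/-- `ℓ` is a limiting point of the pair of circles `C`, `D`: the inversion centred at `ℓ` sends
the two circles to two concentric circles. (The radius of inversion only rescales the images.) -/
def IsLimitingPoint (C D : EuclideanGeometry.Sphere Plane) (ℓ : Plane) : Prop :=
  ∃ (c : Plane) (ρ₁ ρ₂ : ℝ), 0 < ρ₁ ∧ 0 < ρ₂ ∧
    EuclideanGeometry.inversion ℓ 1 '' (C : Set Plane) = Metric.sphere c ρ₁ ∧
    EuclideanGeometry.inversion ℓ 1 '' (D : Set Plane) = Metric.sphere c ρ₂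

/-- The closed polygon with vertices `p j`, indexed cyclically, belongs to the family of Poncelet
`N`-gons interscribed between `C` and `D`: its vertices lie on `C`, and its sidelines (the sides or
their extensions) are tangent to `D`. Consecutive vertices are distinct, and the polygon does not
turn back at a vertex, that is, the two sides that meet at a vertex lie on different tangents. -/
structure IsPonceletPolygon (C D : EuclideanGeometry.Sphere Plane) {N : ℕ}
    (p : ZMod N → Plane) : Prop where
  mem_circle : ∀ j, p j ∈ C
  ne_next : ∀ j, p j ≠ p (j + 1)
  prev_ne_next : ∀ j, p (j - 1) ≠ p (j + 1)
  tangent : ∀ j, D.IsTangent (affineSpan ℝ {p j, p (j + 1)})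

/-- The `j`-th vertex of the pedal polygon of `p` with respect to `x`: the orthogonal projection
of `x` onto the `j`-th sideline, through `p j` and `p (j + 1)`. -/
noncomputable def pedalPolygon {N : ℕ} (p : ZMod N → Plane) (x : Plane) : ZMod N → Plane :=
  fun j => (EuclideanGeometry.orthogonalProjection (affineSpan ℝ {p j, p (j + 1)}) x : Plane)

/-- The perimeter of a closed polygon given by its cyclically indexed vertices. -/
noncomputable def polygonPerimeter {N : ℕ} [NeZero N] (q : ZMod N → Plane) : ℝ :=
  ∑ j, dist (q j) (q (j + 1))

/-!
Let `e j` be the unit vector from the centre `O` of `D` (radius `r`) to the point where the `j`-th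
sideline touches `D`.

*Reduction.* Two consecutive sidelines meet at a vertex `p` of `C`, and the corresponding side of
the pedal polygon has length `|p - ℓ| sin (angle between the sidelines)`. For a limiting point `ℓ`
the square of `|p - ℓ|` is a constant multiple `k` of the power of `p` with respect to `D`, for all
`p` on `C` (`IsLimitingPoint.exists_dist_sq_eq`), and the length becomes
`√k * r * (1 - ⟪e j, e (j + 1)⟫)` (`dist_pedalPolygon`). That the vertex lies on `C` is a symmetric
relation `⟪u, v⟫ - 2 ⟪a, u + v⟫ + K = 0` between `u = e j` and `v = e (j + 1)` (`tangentRel`), with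
`a` and `K` depending only on the two circles. So the perimeter is determined by `∑ ⟪a, e j⟫`, and
it remains to see that this sum is the same for all polygons of the family.

*Invariance of the sum.* Write `F` for the left-hand side of the relation, as a function of the
angles of `u` and `v`. The step `(e j, e (j + 1)) ↦ (e (j + 1), e (j + 2))` of the Poncelet map
is an explicit rational map (`nextContact`), and it carries the Hamiltonian vector field
`(∂F/∂v, -∂F/∂u)` to itself (`velFst_nextContact`, `velSnd_nextContact`). When the common vertex of
two sidelines moves on `C`, the pair of points of tangency moves along that field
(`isFlowPair_contacts`), hence so do all pairs of consecutive points of the chain that it generates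
(`IsFlowPair.chain`). If the chain closes up at one moment then, by uniqueness for ordinary
differential equations, it closes up at all times: this is the closure theorem of Poncelet
(`IsFlowPair.eq_of_eq_at`). Along the motion the derivative of `⟪a, e j⟫` is a difference of
consecutive values of one function of `(e j, e (j + 1))` (`potential_nextContact`), so that the
derivative of the sum over a closed chain telescopes to zero. Parametrising by the position of a
vertex on `C`, and not by a point of tangency, covers nested circles and circles exterior to each
other alike: in the latter case a tangent of `D` need not meet `C`.

Points are treated as complex numbers. The conjugate of a unit vector is its inverse, which makes
the identities above identities of rational functions in `u`, `v`, `a` and `b = conj a`.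
-/

open scoped ComplexConjugate

/-! ### The correspondence between consecutive points of tangency -/

/-- The relation `2 ⟪u, v⟫ - 4 ⟪a, u + v⟫ + 2 K = 0` between two unit vectors `u` and `v`, with
`b` in the place of `conj a` and inverses in the place of conjugates of `u` and `v`. -/
noncomputable def tangentRel (a b K u v : ℂ) : ℂ :=
  u / v + v / u - 2 * (a / u + b * u + a / v + b * v) + 2 * K

/-- The point that follows `u` and `v` in a chain: the mirror image of `u` in the line through `0`
and `v - 2 * a`, which is the other solution of the relation with `v`. -/
noncomputable def nextContact (a b u v : ℂ) : ℂ := (v - 2 * a) / (u * (v⁻¹ - 2 * b))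

/-- The first component of the Hamiltonian vector field of the relation, tangent to the unit circle
at `u`. -/
noncomputable def velFst (a b u v : ℂ) : ℂ := (u ^ 2 / v - 2 * a * u / v - v + 2 * b * u * v) / 2
/-- The second component of the Hamiltonian vector field of the relation, tangent to the unit circle
at `v`. -/
noncomputable def velSnd (a b u v : ℂ) : ℂ := -(v ^ 2 / u - 2 * a * v / u - u + 2 * b * u * v) / 2

theorem tangentRel_nextContact {a b K u v : ℂ} (hu : u ≠ 0) (hv : v ≠ 0)
    (hn : v - 2 * a ≠ 0) (hm : v⁻¹ - 2 * b ≠ 0) :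
    tangentRel a b K v (nextContact a b u v) = tangentRel a b K u v := by
  have hm' : 1 - v * 2 * b ≠ 0 := by
    intro h; apply hm; field_simp; linear_combination h
  unfold tangentRel nextContact
  field_simp
  ring

/-- The velocity of `v` is the same whether it is computed from the preceding or from the following
point of the chain. -/
theorem velFst_nextContact {a b u v : ℂ} (hu : u ≠ 0) (hv : v ≠ 0)
    (hn : v - 2 * a ≠ 0) (hm : v⁻¹ - 2 * b ≠ 0) :
    velFst a b v (nextContact a b u v) = velSnd a b u v := by
  have hm' : 1 - v * 2 * b ≠ 0 := by
    intro h; apply hm; field_simp; linear_combination h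
  unfold velFst velSnd nextContact
  field_simp
  ring

theorem tangentRel_comm {a b K u v : ℂ} : tangentRel a b K v u = tangentRel a b K u v := by
  unfold tangentRel; ring

/-- A function on pairs of consecutive points of a chain whose increments along the chain are the
velocities of `b * v + a / v = 2 ⟪a, v⟫`. -/
noncomputable def potential (a b K u v : ℂ) : ℂ :=
  (b * u - a / u) * (b * v - a / v) / 2 + (b * u - a / u) * (u / v - v / u) / 4
    - ((1 - K) * (b * u + a / u) + (b * u + a / u) ^ 2) / 2

/-- The velocity of `b * v + a / v` is the increment of `potential`. The component of
`nextContact a b u v` along `v - 2 * a` agrees with that of `u`, and the other one is opposite; this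
expresses both terms through `u` and `v`, and what remains is a multiple of the relation. -/
theorem potential_nextContact {a b K u v : ℂ} (hu : u ≠ 0) (hv : v ≠ 0)
    (hn : v - 2 * a ≠ 0) (hm : v⁻¹ - 2 * b ≠ 0) (h : tangentRel a b K u v = 0) :
    velSnd a b u v * (b - a / v ^ 2) =
      potential a b K v (nextContact a b u v) - potential a b K u v := by
  have key : potential a b K v (nextContact a b u v) =
      (b * v - a / v) * (u * (v⁻¹ - 2 * b) - (v - 2 * a) / u) / 4
      - ((1 - K) * (b * v + a / v) + (b * v + a / v) ^ 2) / 2 := by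
    obtain ⟨n, rfl⟩ : ∃ n, a = (v - n) / 2 := ⟨v - 2 * a, by ring⟩
    obtain ⟨m, rfl⟩ : ∃ m, b = (v⁻¹ - m) / 2 := ⟨v⁻¹ - 2 * b, by ring⟩
    have hn' : n ≠ 0 := by rintro rfl; apply hn; ring
    have hm' : m ≠ 0 := by rintro rfl; apply hm; ring
    have hw : nextContact ((v - n) / 2) ((v⁻¹ - m) / 2) u v = n / (u * m) := by
      unfold nextContact; ring_nf
    rw [hw]
    unfold potential
    field_simp
    ring
  rw [key]
  unfold tangentRel at h
  unfold potential velSnd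
  have e : b - a / v ^ 2 = (b * v - a / v) / v := by field_simp
  rw [e]
  field_simp at h ⊢
  linear_combination 2 * (v * (b * u ^ 2 + a) - u * (b * v ^ 2 + a)) * h

/-- The second component of the field at the next pair is the derivative of `nextContact` in the
direction of the field: its logarithmic derivative is the bracket on the right. -/
theorem velSnd_nextContact {a b u v : ℂ} (hu : u ≠ 0) (hv : v ≠ 0)
    (hn : v - 2 * a ≠ 0) (hm : v⁻¹ - 2 * b ≠ 0) :
    velSnd a b v (nextContact a b u v) = nextContact a b u v *
      (velSnd a b u v / (v - 2 * a) - velFst a b u v / u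
        + velSnd a b u v / (v ^ 2 * (v⁻¹ - 2 * b))) := by
  have hm' : 1 - v * 2 * b ≠ 0 := by
    intro h; apply hm; field_simp; linear_combination h
  unfold velFst velSnd nextContact
  field_simp
  grind

/-- The relation with `v` is quadratic in the other point, so that two different solutions determine
each other. -/
theorem eq_nextContact_of_ne {a b K u v w : ℂ} (hu : u ≠ 0) (hv : v ≠ 0) (hw : w ≠ 0)
    (hm : v⁻¹ - 2 * b ≠ 0) (h1 : tangentRel a b K u v = 0)
    (h2 : tangentRel a b K v w = 0) (huw : u ≠ w) : w = nextContact a b u v := by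
  have hm' : 1 - v * 2 * b ≠ 0 := by
    intro h; apply hm; field_simp; linear_combination h
  unfold tangentRel at h1 h2
  unfold nextContact
  field_simp at h1 h2 ⊢
  apply mul_left_cancel₀ (sub_ne_zero.2 huw)
  linear_combination w * h1 - u * h2

/-! ### Chains of points of tangency and their common flow -/

/-- The chain of points, as functions of a parameter, generated by the first two, `u` and `v`. -/
noncomputable def contactChain (a b : ℂ) (u v : ℝ → ℂ) : ℕ → ℝ → ℂ
  | 0 => u
  | 1 => v
  | n + 2 => fun t => nextContact a b (contactChain a b u v n t) (contactChain a b u v (n + 1) t)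

theorem conj_of_norm_one {u : ℂ} (hu : ‖u‖ = 1) : conj u = u⁻¹ :=
  (Complex.inv_eq_conj hu).symm

theorem ne_zero_of_norm_one {u : ℂ} (hu : ‖u‖ = 1) : u ≠ 0 := by
  rintro rfl; simp at hu

theorem inv_sub_conj_of_norm_one {a v : ℂ} (hv : ‖v‖ = 1) :
    v⁻¹ - 2 * conj a = conj (v - 2 * a) := by
  rw [map_sub, map_mul, conj_of_norm_one hv, map_ofNat]

/-- If `v = 2 * a` the relation no longer depends on `u`; it is then satisfied only for `K = 1`. -/
theorem sub_ne_zero_of_rel {a K u v : ℂ} (hv : ‖v‖ = 1) (hK : K ≠ 1)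
    (h : tangentRel a (conj a) K u v = 0) (hu : u ≠ 0) : v - 2 * a ≠ 0 := by
  intro h0
  have h1 : v⁻¹ - 2 * conj a = 0 := by rw [inv_sub_conj_of_norm_one hv, h0, map_zero]
  have hv0 := ne_zero_of_norm_one hv
  apply hK
  have e1 : a = v / 2 := by linear_combination -h0 / 2
  have e2 : conj a = v⁻¹ / 2 := by linear_combination -h1 / 2
  rw [e2, e1] at h
  unfold tangentRel at h
  field_simp at h
  have h2 : (u * v) * (K - 1) = 0 := by linear_combination h / 2
  have := (mul_eq_zero.1 h2).resolve_left (mul_ne_zero hu hv0)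
  linear_combination this

theorem inv_sub_ne_zero_of_rel {a K u v : ℂ} (hv : ‖v‖ = 1) (hK : K ≠ 1)
    (h : tangentRel a (conj a) K u v = 0) (hu : u ≠ 0) : v⁻¹ - 2 * conj a ≠ 0 := by
  rw [inv_sub_conj_of_norm_one hv]
  exact (map_ne_zero _).2 (sub_ne_zero_of_rel hv hK h hu)

theorem norm_nextContact {a K u v : ℂ} (hu : ‖u‖ = 1) (hv : ‖v‖ = 1) (hK : K ≠ 1)
    (h : tangentRel a (conj a) K u v = 0) : ‖nextContact a (conj a) u v‖ = 1 := by
  have := sub_ne_zero_of_rel hv hK h (ne_zero_of_norm_one hu)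
  unfold nextContact
  rw [inv_sub_conj_of_norm_one hv, norm_div, norm_mul, hu, one_mul, RCLike.norm_conj]
  exact div_self (norm_ne_zero_iff.2 this)

theorem contactChain_rel {a K : ℂ} {u v : ℝ → ℂ} {t : ℝ} (hK : K ≠ 1) (hu : ‖u t‖ = 1)
    (hv : ‖v t‖ = 1) (h : tangentRel a (conj a) K (u t) (v t) = 0) (n : ℕ) :
    ‖contactChain a (conj a) u v n t‖ = 1 ∧ ‖contactChain a (conj a) u v (n + 1) t‖ = 1 ∧
    tangentRel a (conj a) K (contactChain a (conj a) u v n t)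
      (contactChain a (conj a) u v (n + 1) t) = 0 := by
  induction n with
  | zero => exact ⟨hu, hv, h⟩
  | succ n ih =>
    obtain ⟨h1, h2, h3⟩ := ih
    refine ⟨h2, norm_nextContact h1 h2 hK h3, ?_⟩
    exact (tangentRel_nextContact (ne_zero_of_norm_one h1) (ne_zero_of_norm_one h2)
      (sub_ne_zero_of_rel h2 hK h3 (ne_zero_of_norm_one h1))
      (inv_sub_ne_zero_of_rel h2 hK h3 (ne_zero_of_norm_one h1))).trans h3

/-- A pair of points on the unit circle that satisfies the relation and moves along its Hamiltonian
vector field, with a speed factor `lam` that may depend on time. -/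
structure IsFlowPair (a K : ℂ) (lam : ℝ → ℝ) (u v : ℝ → ℂ) : Prop where
  norm_fst : ∀ t, ‖u t‖ = 1
  norm_snd : ∀ t, ‖v t‖ = 1
  rel : ∀ t, tangentRel a (conj a) K (u t) (v t) = 0
  deriv_fst : ∀ t, HasDerivAt u (lam t * velFst a (conj a) (u t) (v t)) t
  deriv_snd : ∀ t, HasDerivAt v (lam t * velSnd a (conj a) (u t) (v t)) t

/-- The Poncelet map preserves the Hamiltonian field: every pair of consecutive points of the chain
moves along the field with the same speed factor. -/
theorem IsFlowPair.chain {a K : ℂ} {lam : ℝ → ℝ} {u v : ℝ → ℂ} (hK : K ≠ 1)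
    (h : IsFlowPair a K lam u v) (n : ℕ) :
    IsFlowPair a K lam (contactChain a (conj a) u v n) (contactChain a (conj a) u v (n + 1)) := by
  induction n with
  | zero => exact h
  | succ n ih =>
    have key := fun t => contactChain_rel hK (h.norm_fst t) (h.norm_snd t) (h.rel t) (n + 1)
    have n1 := fun t => ne_zero_of_norm_one (ih.norm_fst t)
    have n2 := fun t => ne_zero_of_norm_one (ih.norm_snd t)
    have n3 := fun t => sub_ne_zero_of_rel (ih.norm_snd t) hK (ih.rel t) (n1 t)
    have n4 := fun t => inv_sub_ne_zero_of_rel (ih.norm_snd t) hK (ih.rel t) (n1 t)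
    refine ⟨fun t => (key t).1, fun t => (key t).2.1, fun t => (key t).2.2, fun t => ?_,
      fun t => ?_⟩
    · have := velFst_nextContact (n1 t) (n2 t) (n3 t) (n4 t)
      have h2 := ih.deriv_snd t
      rw [← this] at h2
      exact h2
    · have h1 := ih.deriv_fst t
      have h2 := ih.deriv_snd t
      have e : velSnd a (conj a) _ (contactChain a (conj a) u v (n + 1 + 1) t) = _ :=
        velSnd_nextContact (n1 t) (n2 t) (n3 t) (n4 t)
      rw [e]
      have h3 := (h2.sub_const (2 * a)).div (h1.mul ((h2.inv (n2 t)).sub_const (2 * conj a)))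
        (mul_ne_zero (n1 t) (n4 t))
      refine h3.congr_deriv ?_
      have i1 := n1 t
      have i2 := n2 t
      have i3 := n3 t
      have i4 := n4 t
      unfold nextContact
      simp only [Pi.mul_apply, Pi.inv_apply]
      generalize velFst a _ _ _ = X
      generalize velSnd a _ _ _ = Y
      generalize hm : (contactChain a (conj a) u v (n + 1) t)⁻¹ - 2 * conj a = m at *
      generalize hn : (contactChain a (conj a) u v (n + 1) t) - 2 * a = n at *
      field_simp
      ring

/-- For a chain that is closed at all times the derivative of the sum telescopes to zero. -/
theorem IsFlowPair.sum_eq_of_periodic {a K : ℂ} {lam : ℝ → ℝ} {u v : ℝ → ℂ} (hK : K ≠ 1)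
    (h : IsFlowPair a K lam u v) {N : ℕ}
    (h0 : ∀ t, contactChain a (conj a) u v N t = u t)
    (h1 : ∀ t, contactChain a (conj a) u v (N + 1) t = v t) (t t' : ℝ) :
    ∑ j ∈ Finset.range N, (conj a * contactChain a (conj a) u v (j + 1) t
      + a / contactChain a (conj a) u v (j + 1) t) =
    ∑ j ∈ Finset.range N, (conj a * contactChain a (conj a) u v (j + 1) t'
      + a / contactChain a (conj a) u v (j + 1) t') := by
  set c := contactChain a (conj a) u v with hc
  have hd : ∀ t, HasDerivAt (fun t => ∑ j ∈ Finset.range N, (conj a * c (j + 1) t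
      + a / c (j + 1) t)) 0 t := by
    intro t
    have hj : ∀ j ∈ Finset.range N, HasDerivAt (fun t => conj a * c (j + 1) t + a / c (j + 1) t)
        (lam t * (potential a (conj a) K (c (j + 1) t) (c (j + 1 + 1) t) -
          potential a (conj a) K (c j t) (c (j + 1) t))) t := by
      intro j _
      have ih := h.chain hK j
      have n1 := ne_zero_of_norm_one (ih.norm_fst t)
      have n2 := ne_zero_of_norm_one (ih.norm_snd t)
      have n3 := sub_ne_zero_of_rel (ih.norm_snd t) hK (ih.rel t) n1
      have n4 := inv_sub_ne_zero_of_rel (ih.norm_snd t) hK (ih.rel t) n1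
      have e := potential_nextContact n1 n2 n3 n4 (ih.rel t)
      have d := ih.deriv_snd t
      rw [← hc] at *
      have e' : _ = potential a (conj a) K (c (j + 1) t) (c (j + 1 + 1) t) -
          potential a (conj a) K (c j t) (c (j + 1) t) := e
      rw [← e']
      refine ((d.const_mul (conj a)).add ((d.inv n2).const_mul a)).congr_deriv ?_
      field_simp
      ring
    refine (HasDerivAt.fun_sum hj).congr_deriv ?_
    rw [← Finset.mul_sum, Finset.sum_range_sub (fun j =>
      potential a (conj a) K (c j t) (c (j + 1) t)), h0, h1]
    exact mul_eq_zero_of_right _ (sub_self _)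
  exact is_const_of_deriv_eq_zero (fun t => (hd t).differentiableAt) (fun t => (hd t).deriv) t t'

/-! ### Uniqueness of the flow and invariance of the centroid sum -/

/-- On the torus the field agrees with a polynomial in the coordinates and their conjugates. -/
theorem exists_lipschitzOnWith_vel (a : ℂ) : ∃ L : NNReal, LipschitzOnWith L
    (fun z : ℂ × ℂ => (velFst a (conj a) z.1 z.2, velSnd a (conj a) z.1 z.2))
    (Metric.sphere 0 1 ×ˢ Metric.sphere 0 1) := by
  let V : ℂ × ℂ → ℂ × ℂ := fun z =>
    ((z.1 ^ 2 * conj z.2 - 2 * a * z.1 * conj z.2 - z.2 + 2 * conj a * z.1 * z.2) / 2,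
      -(z.2 ^ 2 * conj z.1 - 2 * a * z.2 * conj z.1 - z.1 + 2 * conj a * z.1 * z.2) / 2)
  have hc : ContDiff ℝ 1 (fun z : ℂ => conj z) := Complex.conjCLE.contDiff
  have hV : ContDiff ℝ 1 V := by
    have h1 : ContDiff ℝ 1 (fun z : ℂ × ℂ => conj z.1) := hc.comp contDiff_fst
    have h2 : ContDiff ℝ 1 (fun z : ℂ × ℂ => conj z.2) := hc.comp contDiff_snd
    fun_prop
  obtain ⟨L, hL⟩ := hV.locallyLipschitz.locallyLipschitzOn
    (s := Metric.sphere (0 : ℂ) 1 ×ˢ Metric.sphere (0 : ℂ) 1)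
    |>.exists_lipschitzOnWith_of_compact ((isCompact_sphere _ _).prod (isCompact_sphere _ _))
  have hEq : ∀ z ∈ Metric.sphere (0 : ℂ) 1 ×ˢ Metric.sphere (0 : ℂ) 1,
      (velFst a (conj a) z.1 z.2, velSnd a (conj a) z.1 z.2) = V z := by
    intro z hz
    simp only [Set.mem_prod, mem_sphere_zero_iff_norm] at hz
    simp only [V, velFst, velSnd, conj_of_norm_one hz.1, conj_of_norm_one hz.2, div_eq_mul_inv]
  refine ⟨L, fun z hz w hw => ?_⟩
  simpa only [hEq z hz, hEq w hw] using hL hz hw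

/-- Two pairs that move with the same bounded speed factor and meet once are equal at all times. -/
theorem IsFlowPair.eq_of_eq_at {a K : ℂ} {lam : ℝ → ℝ} {u v u' v' : ℝ → ℂ} {M : ℝ}
    (hM : ∀ t, |lam t| ≤ M) (h : IsFlowPair a K lam u v) (h' : IsFlowPair a K lam u' v') {t₀ : ℝ}
    (hu : u t₀ = u' t₀) (hv : v t₀ = v' t₀) : u = u' ∧ v = v' := by
  obtain ⟨L, hL⟩ := exists_lipschitzOnWith_vel a
  have hlip : ∀ t, LipschitzOnWith (M.toNNReal * L)
      (fun z : ℂ × ℂ => lam t • (velFst a (conj a) z.1 z.2, velSnd a (conj a) z.1 z.2))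
      (Metric.sphere 0 1 ×ˢ Metric.sphere 0 1) := by
    intro t
    refine LipschitzOnWith.of_dist_le_mul fun x hx y hy => ?_
    rw [dist_smul₀, NNReal.coe_mul, mul_assoc]
    exact mul_le_mul ((hM t).trans (Real.le_coe_toNNReal M)) (hL.dist_le_mul x hx y hy)
      dist_nonneg (NNReal.coe_nonneg _)
  have key : ∀ {u v : ℝ → ℂ}, IsFlowPair a K lam u v → ∀ t,
      HasDerivAt (fun t => (u t, v t)) (lam t • (velFst a (conj a) (u t) (v t),
        velSnd a (conj a) (u t) (v t))) t ∧
      (u t, v t) ∈ Metric.sphere (0 : ℂ) 1 ×ˢ Metric.sphere (0 : ℂ) 1 := by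
    intro u v h t
    refine ⟨?_, by simp [h.norm_fst t, h.norm_snd t]⟩
    refine ((h.deriv_fst t).prodMk (h.deriv_snd t)).congr_deriv ?_
    simp
  have e := ODE_solution_unique_univ hlip (key h) (key h') (t₀ := t₀) (by simp [hu, hv])
  exact ⟨funext fun t => congrArg Prod.fst (congrFun e t),
    funext fun t => congrArg Prod.snd (congrFun e t)⟩

theorem IsFlowPair.sum_eq_of_closed {a K : ℂ} {lam : ℝ → ℝ} {u v : ℝ → ℂ} {M : ℝ}
    (hM : ∀ t, |lam t| ≤ M) (hK : K ≠ 1) (h : IsFlowPair a K lam u v) {N : ℕ} {t₀ : ℝ}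
    (h0 : contactChain a (conj a) u v N t₀ = u t₀)
    (h1 : contactChain a (conj a) u v (N + 1) t₀ = v t₀) (t t' : ℝ) :
    ∑ j ∈ Finset.range N, (conj a * contactChain a (conj a) u v (j + 1) t
      + a / contactChain a (conj a) u v (j + 1) t) =
    ∑ j ∈ Finset.range N, (conj a * contactChain a (conj a) u v (j + 1) t'
      + a / contactChain a (conj a) u v (j + 1) t') := by
  obtain ⟨e0, e1⟩ := (h.chain hK N).eq_of_eq_at hM h h0 h1
  exact h.sum_eq_of_periodic hK (congrFun e0) (congrFun e1) t t'

/-! ### The two tangents from a moving vertex -/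

/-- Here and in the next two lemmas `p = q * u * v` is a point outside a circle of radius
`r = q * (u + v) / 2` about `0`, with `q = conj p`, and `u`, `v` are the directions of its points of
tangency. If `p` lies on the circle of radius `R` about `β`, then `q * D = β * conj β - R ^ 2`. The
variables `u`, `v`, `q` parametrise the situation rationally, and `γ` stands for `conj β`. -/
theorem tangentRel_of_contacts {u v q β γ D : ℂ} (hu : u ≠ 0) (hv : v ≠ 0) (hD : D ≠ 0)
    (hDe : D = u * v * γ + β - q * u * v) :
    tangentRel ((u + v) * β / (2 * D)) ((u + v) * γ / (2 * D)) (1 + q * (u + v) ^ 2 / (2 * D))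
      u v = 0 := by
  unfold tangentRel
  field_simp
  rw [hDe]
  ring

theorem velSnd_of_contacts {u v q β γ D : ℂ} (hu : u ≠ 0) (hD : D ≠ 0)
    (huv : v ^ 2 - u ^ 2 ≠ 0) (hq : q ≠ 0) (hDe : D = u * v * γ + β - q * u * v) :
    2 * Complex.I * D / (q * (v ^ 2 - u ^ 2)) *
      velSnd ((u + v) * β / (2 * D)) ((u + v) * γ / (2 * D)) u v =
    Complex.I * v * (q - γ) / q - Complex.I * (γ * u * v - β) / (q * (v - u)) := by
  have h1 : v - u ≠ 0 := fun h => huv (by linear_combination (v + u) * h)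
  have h2 : v + u ≠ 0 := fun h => huv (by linear_combination (v - u) * h)
  rw [show v ^ 2 - u ^ 2 = (v - u) * (v + u) by ring]
  unfold velSnd
  field_simp
  rw [hDe]
  ring

theorem velFst_of_contacts {u v q β γ D : ℂ} (hv : v ≠ 0) (hD : D ≠ 0)
    (huv : v ^ 2 - u ^ 2 ≠ 0) (hq : q ≠ 0) (hDe : D = u * v * γ + β - q * u * v) :
    2 * Complex.I * D / (q * (v ^ 2 - u ^ 2)) *
      velFst ((u + v) * β / (2 * D)) ((u + v) * γ / (2 * D)) u v =
    Complex.I * u * (q - γ) / q + Complex.I * (γ * u * v - β) / (q * (v - u)) := by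
  have h1 : v - u ≠ 0 := fun h => huv (by linear_combination (v + u) * h)
  have h2 : v + u ≠ 0 := fun h => huv (by linear_combination (v - u) * h)
  rw [show v ^ 2 - u ^ 2 = (v - u) * (v + u) by ring]
  unfold velFst
  field_simp
  rw [hDe]
  ring

/-- The point at angle `t` on the circle of radius `R` about `β`. -/
noncomputable def circlePoint (β : ℂ) (R t : ℝ) : ℂ := β + R * Complex.exp (t * Complex.I)

/-- The length of the tangents from `p` to the circle of radius `r` about `0`. -/
noncomputable def tangentLength (r : ℝ) (p : ℂ) : ℝ := √(Complex.normSq p - r ^ 2)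

/-- The direction of one of the two points where tangents from `p` touch the circle of radius `r`
about `0`; the other one is `contactLeft r p`. -/
noncomputable def contactRight (r : ℝ) (p : ℂ) : ℂ := (r - tangentLength r p * Complex.I) / conj p

/-- The direction of the point of tangency on the other side of `p` from `contactRight r p`. -/
noncomputable def contactLeft (r : ℝ) (p : ℂ) : ℂ := (r + tangentLength r p * Complex.I) / conj p

theorem tangentLength_sq {r : ℝ} {p : ℂ} (h : r ^ 2 < Complex.normSq p) :
    (tangentLength r p : ℂ) ^ 2 = p * conj p - r ^ 2 := by
  rw [Complex.mul_conj]
  exact_mod_cast Real.sq_sqrt (sub_pos.2 h).le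

theorem tangentLength_pos {r : ℝ} {p : ℂ} (h : r ^ 2 < Complex.normSq p) :
    0 < tangentLength r p := Real.sqrt_pos.2 (sub_pos.2 h)

theorem ne_zero_of_outside {r : ℝ} {p : ℂ} (h : r ^ 2 < Complex.normSq p) : p ≠ 0 := by
  rintro rfl
  rw [map_zero] at h
  exact absurd h (not_lt.2 (sq_nonneg r))

theorem mul_contacts {r : ℝ} {p : ℂ} (h : r ^ 2 < Complex.normSq p) :
    conj p * contactRight r p * contactLeft r p = p := by
  have h0 : conj p ≠ 0 := (map_ne_zero _).2 (ne_zero_of_outside h)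
  have := tangentLength_sq h
  unfold contactRight contactLeft
  field_simp
  linear_combination this - tangentLength r p ^ 2 * Complex.I_sq

theorem norm_contacts {r : ℝ} {p : ℂ} (h : r ^ 2 < Complex.normSq p) :
    ‖contactRight r p‖ = 1 ∧ ‖contactLeft r p‖ = 1 := by
  have h0 : p ≠ 0 := (ne_zero_of_outside h)
  have h1 : tangentLength r p ^ 2 = Complex.normSq p - r ^ 2 := Real.sq_sqrt (sub_pos.2 h).le
  have e1 : ‖(r : ℂ) - tangentLength r p * Complex.I‖ = ‖p‖ := by
    rw [Complex.norm_def, Complex.norm_def]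
    congr 1
    simp [Complex.normSq_apply] at h1 ⊢
    linear_combination h1
  have e2 : ‖(r : ℂ) + tangentLength r p * Complex.I‖ = ‖p‖ := by
    rw [Complex.norm_def, Complex.norm_def]
    congr 1
    simp [Complex.normSq_apply] at h1 ⊢
    linear_combination h1
  unfold contactRight contactLeft
  rw [norm_div, norm_div, e1, e2, RCLike.norm_conj]
  exact ⟨div_self (norm_ne_zero_iff.2 h0), div_self (norm_ne_zero_iff.2 h0)⟩

theorem hasDerivAt_circlePoint (β : ℂ) (R t : ℝ) :
    HasDerivAt (circlePoint β R) (Complex.I * (circlePoint β R t - β)) t := by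
  have h1 : HasDerivAt (fun t : ℝ => (t : ℂ) * Complex.I) (1 * Complex.I) t :=
    (Complex.ofRealCLM.hasDerivAt).mul_const _
  refine ((h1.cexp.const_mul (R : ℂ)).const_add β).congr_deriv ?_
  unfold circlePoint
  ring

theorem hasDerivAt_conj_circlePoint (β : ℂ) (R t : ℝ) :
    HasDerivAt (fun t => conj (circlePoint β R t))
      (-Complex.I * (conj (circlePoint β R t) - conj β)) t := by
  refine (Complex.conjCLE.hasFDerivAt.comp_hasDerivAt t
    (hasDerivAt_circlePoint β R t)).congr_deriv ?_
  simp

theorem hasDerivAt_tangentLength {β : ℂ} {R r t : ℝ}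
    (h : r ^ 2 < Complex.normSq (circlePoint β R t)) :
    HasDerivAt (fun t => (tangentLength r (circlePoint β R t) : ℂ))
      (Complex.I * (conj β * circlePoint β R t - β * conj (circlePoint β R t)) /
        (2 * tangentLength r (circlePoint β R t))) t := by
  have h1 := (hasDerivAt_circlePoint β R t).mul (hasDerivAt_conj_circlePoint β R t)
  have h2 := Complex.reCLM.hasFDerivAt.comp_hasDerivAt t h1
  have h3 : HasDerivAt (fun t => Complex.normSq (circlePoint β R t) - r ^ 2) _ t :=
    (h2.sub_const (r ^ 2)).congr_of_eventuallyEq (.of_forall fun t => by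
      simp [Complex.mul_conj])
  have h4 := (h3.sqrt (sub_pos.2 h).ne').ofReal_comp
  refine h4.congr_deriv ?_
  rw [Complex.ofReal_div]
  congr 1
  · rw [Complex.reCLM_apply, Complex.conj_eq_iff_re.1]
    · ring
    · simp; ring
  · simp [tangentLength]

/-- When `p` moves uniformly on the circle about `β`, its two points of tangency move along the
Hamiltonian field. The speed factor is the power of `0` divided by `2 * r` and by the tangent
length. -/
theorem isFlowPair_contacts {β : ℂ} {R r : ℝ} (hr : 0 < r)
    (h : ∀ t, r ^ 2 < Complex.normSq (circlePoint β R t)) (hB : Complex.normSq β - R ^ 2 ≠ 0) :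
    IsFlowPair (r * β / (Complex.normSq β - R ^ 2 : ℝ))
      (1 + 2 * r ^ 2 / (Complex.normSq β - R ^ 2 : ℝ))
      (fun t => (Complex.normSq β - R ^ 2) / (2 * r * tangentLength r (circlePoint β R t)))
      (fun t => contactRight r (circlePoint β R t))
      (fun t => contactLeft r (circlePoint β R t)) := by
  have hB' : ((Complex.normSq β - R ^ 2 : ℝ) : ℂ) ≠ 0 := Complex.ofReal_ne_zero.2 hB
  have hr' : (r : ℂ) ≠ 0 := Complex.ofReal_ne_zero.2 hr.ne'
  have hconj : conj (r * β / (Complex.normSq β - R ^ 2 : ℝ)) =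
      r * conj β / (Complex.normSq β - R ^ 2 : ℝ) := by simp
  -- The equation of the circle about `β`, solved for the power of `0`.
  have hcirc : ∀ t, ((Complex.normSq β - R ^ 2 : ℝ) : ℂ) =
      circlePoint β R t * conj β + conj (circlePoint β R t) * β
        - circlePoint β R t * conj (circlePoint β R t) := by
    intro t
    have e1 : Complex.exp (t * Complex.I) * conj (Complex.exp (t * Complex.I)) = 1 := by
      rw [Complex.mul_conj, Complex.normSq_eq_norm_sq, Complex.norm_exp_ofReal_mul_I]; simp
    have e2 : ((Complex.normSq β : ℝ) : ℂ) = β * conj β := (Complex.mul_conj β).symm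
    push_cast
    rw [e2]
    simp only [circlePoint, map_add, map_mul, Complex.conj_ofReal]
    linear_combination (R : ℂ) ^ 2 * e1
  refine ⟨fun t => (norm_contacts (h t)).1, fun t => (norm_contacts (h t)).2, ?_, ?_, ?_⟩
  all_goals
    intro t
    have hs := tangentLength_pos (h t)
    have hs' : (tangentLength r (circlePoint β R t) : ℂ) ≠ 0 := Complex.ofReal_ne_zero.2 hs.ne'
    have hp := ne_zero_of_outside (h t)
    have hq : conj (circlePoint β R t) ≠ 0 := (map_ne_zero _).2 hp
    have hu := ne_zero_of_norm_one (norm_contacts (h t)).1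
    have hv := ne_zero_of_norm_one (norm_contacts (h t)).2
    have hpe := mul_contacts (h t)
    have hue : contactRight r (circlePoint β R t) =
      (r - tangentLength r (circlePoint β R t) * Complex.I) / conj (circlePoint β R t) := rfl
    have hve : contactLeft r (circlePoint β R t) =
      (r + tangentLength r (circlePoint β R t) * Complex.I) / conj (circlePoint β R t) := rfl
    have hc := hcirc t
    have d1 := hasDerivAt_conj_circlePoint β R t
    have d2 := hasDerivAt_tangentLength (h t)
    have d3 := (d2.mul_const Complex.I).const_sub (r : ℂ) |>.div d1 hq
    have d4 := (d2.mul_const Complex.I).const_add (r : ℂ) |>.div d1 hq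
    rw [hconj]
    have hlam : (((Complex.normSq β - R ^ 2) /
        (2 * r * tangentLength r (circlePoint β R t)) : ℝ) : ℂ) =
      ((Complex.normSq β - R ^ 2 : ℝ) : ℂ) / (2 * r * tangentLength r (circlePoint β R t)) := by
      push_cast; rfl
    try rw [hlam]
    clear hlam
    generalize ((Complex.normSq β - R ^ 2 : ℝ) : ℂ) = B at *
    generalize hss : (tangentLength r (circlePoint β R t) : ℂ) = s at *
    generalize huu : contactRight r (circlePoint β R t) = u at *
    generalize hvv : contactLeft r (circlePoint β R t) = v at *
    generalize hqq : conj (circlePoint β R t) = q at *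
    have hsum : u + v = 2 * r / q := by rw [hue, hve]; ring
    have hdiff : v - u = 2 * (s * Complex.I) / q := by rw [hue, hve]; ring
    have hsq : v ^ 2 - u ^ 2 = 2 * (s * Complex.I) / q * (2 * r / q) := by
      rw [← hsum, ← hdiff]; ring
    have hsq0 : v ^ 2 - u ^ 2 ≠ 0 := by
      rw [hsq]
      exact mul_ne_zero (div_ne_zero (mul_ne_zero two_ne_zero (mul_ne_zero hs' Complex.I_ne_zero))
        hq) (div_ne_zero (mul_ne_zero two_ne_zero hr') hq)
    have hD : B / q = u * v * conj β + β - q * u * v := by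
      rw [hc, ← hpe]; field_simp
    have hD0 : B / q ≠ 0 := div_ne_zero hB' hq
    have ea : ∀ γ : ℂ, r * γ / B = (u + v) * γ / (2 * (B / q)) := by
      intro γ; rw [hsum]; field_simp
    have eK : 1 + 2 * (r : ℂ) ^ 2 / B = 1 + q * (u + v) ^ 2 / (2 * (B / q)) := by
      rw [hsum]; field_simp
    have el : B / (2 * r * s) = 2 * Complex.I * (B / q) / (q * (v ^ 2 - u ^ 2)) := by
      rw [hsq]
      have := Complex.I_ne_zero
      field_simp
    rw [ea β, ea (conj β)]
    try rw [eK]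
    try rw [el]
  · exact tangentRel_of_contacts hu hv hD0 hD
  · rw [velFst_of_contacts hv hD0 hsq0 hq hD, hdiff]
    refine d3.congr_deriv ?_
    rw [← hpe, show (r : ℂ) - s * Complex.I = u * q by rw [hue]; field_simp]
    have := Complex.I_ne_zero
    field_simp
    linear_combination -q * (conj β * u * v - β) * Complex.I_sq
  · rw [velSnd_of_contacts hu hD0 hsq0 hq hD, hdiff]
    refine d4.congr_deriv ?_
    rw [← hpe, show (r : ℂ) + s * Complex.I = v * q by rw [hve]; field_simp]
    have := Complex.I_ne_zero
    field_simp
    linear_combination q * (conj β * u * v - β) * Complex.I_sq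

/-! ### Closed tangent polygons -/

theorem ZMod.sum_eq_sum_range {M : Type*} [AddCommMonoid M] (N : ℕ) [NeZero N] (f : ZMod N → M) :
    ∑ j, f j = ∑ i ∈ Finset.range N, f (i : ZMod N) := by
  obtain ⟨k, rfl⟩ := Nat.exists_eq_succ_of_ne_zero (NeZero.ne N)
  rw [← Fin.sum_univ_eq_sum_range (fun i => f (i : ZMod (k + 1)))]
  exact Finset.sum_congr rfl fun i _ => congrArg f (Fin.cast_val_eq_self i).symm

theorem exists_circlePoint_eq {β p : ℂ} {R : ℝ} (h : ‖p - β‖ = R) :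
    ∃ t, circlePoint β R t = p := by
  refine ⟨(p - β).arg, ?_⟩
  rw [circlePoint, ← h, Complex.norm_mul_exp_arg_mul_I]
  ring

theorem norm_circlePoint_sub {β : ℂ} {R : ℝ} (hR : 0 < R) (t : ℝ) :
    ‖circlePoint β R t - β‖ = R := by
  simp [circlePoint, Complex.norm_exp_ofReal_mul_I, abs_of_pos hR]

/-- The circle about `β` is connected, so it stays outside the other circle if it does so anywhere. -/
theorem outside_of_disjoint {β : ℂ} {R r : ℝ}
    (hdis : ∀ t, Complex.normSq (circlePoint β R t) ≠ r ^ 2) {t₁ : ℝ}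
    (h₁ : r ^ 2 ≤ Complex.normSq (circlePoint β R t₁)) (t : ℝ) :
    r ^ 2 < Complex.normSq (circlePoint β R t) := by
  by_contra! h
  have hc : Continuous fun t => Complex.normSq (circlePoint β R t) := by
    unfold circlePoint
    exact Complex.continuous_normSq.comp (by fun_prop)
  obtain ⟨t₂, h₂⟩ := mem_range_of_exists_le_of_exists_ge hc ⟨t, h⟩ ⟨t₁, h₁⟩
  exact hdis t₂ h₂

theorem power_ne_zero_of_outside {β : ℂ} {R r : ℝ} (hR : 0 < R)
    (h : ∀ t, r ^ 2 < Complex.normSq (circlePoint β R t)) : Complex.normSq β - R ^ 2 ≠ 0 := by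
  intro h0
  have : ‖(0 : ℂ) - β‖ = R := by
    rw [zero_sub, norm_neg, Complex.norm_def, sub_eq_zero.1 h0, Real.sqrt_sq hR.le]
  obtain ⟨t, ht⟩ := exists_circlePoint_eq this
  have := h t
  rw [ht, map_zero] at this
  nlinarith

theorem exists_bound_of_outside {β : ℂ} {R r : ℝ} (hr : 0 < r)
    (h : ∀ t, r ^ 2 < Complex.normSq (circlePoint β R t)) :
    ∃ M, ∀ t, |(Complex.normSq β - R ^ 2) / (2 * r * tangentLength r (circlePoint β R t))| ≤ M := by
  set f : ℝ → ℝ := fun t =>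
    |(Complex.normSq β - R ^ 2) / (2 * r * tangentLength r (circlePoint β R t))| with hf
  have hc : Continuous f := by
    have h1 : Continuous fun t => tangentLength r (circlePoint β R t) := by
      unfold circlePoint tangentLength
      exact Real.continuous_sqrt.comp ((Complex.continuous_normSq.comp
        (by fun_prop : Continuous fun t : ℝ => β + R * Complex.exp (t * Complex.I))).sub
        continuous_const)
    exact (continuous_const.div (continuous_const.mul h1) fun t =>
      mul_ne_zero (by positivity) (tangentLength_pos (h t)).ne').abs
  have hp : Function.Periodic f (2 * Real.pi) := by
    intro t
    have : circlePoint β R (t + 2 * Real.pi) = circlePoint β R t := by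
      unfold circlePoint
      push_cast
      rw [add_mul, Complex.exp_add, Complex.exp_two_pi_mul_I, mul_one]
    simp only [hf, this]
  obtain ⟨M, hM⟩ := (hp.compact_of_continuous (by positivity) hc).bddAbove
  exact ⟨M, fun t => hM ⟨t, rfl⟩⟩

theorem tangent_contact_cases {r : ℝ} {p e : ℂ} (h : r ^ 2 < Complex.normSq p) (he : ‖e‖ = 1)
    (hep : e * conj p + conj e * p = 2 * r) : e = contactRight r p ∨ e = contactLeft r p := by
  have hq : conj p ≠ 0 := (map_ne_zero _).2 (ne_zero_of_outside h)
  have he0 := ne_zero_of_norm_one he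
  rw [conj_of_norm_one he] at hep
  field_simp at hep
  -- For a unit vector `e` the tangency condition is a quadratic equation in `e * conj p`.
  have h1 : (e * conj p - (r - tangentLength r p * Complex.I)) *
      (e * conj p - (r + tangentLength r p * Complex.I)) = 0 := by
    linear_combination conj p * hep + tangentLength_sq h - tangentLength r p ^ 2 * Complex.I_sq
  rcases mul_eq_zero.1 h1 with h2 | h2
  · left
    rw [contactRight, eq_div_iff hq]
    exact sub_eq_zero.1 h2
  · right
    rw [contactLeft, eq_div_iff hq]
    exact sub_eq_zero.1 h2

/-- The closed polygon with vertices `P j` on the circle of radius `R` about `β` has its sideline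
through `P j` and `P (j + 1)` tangent to the circle of radius `r` about `0` at `r * e j`. The last
two fields say that consecutive sidelines, and consecutive vertices, are distinct. -/
structure IsTangentPolygon (β : ℂ) (R r : ℝ) {N : ℕ} (e P : ZMod N → ℂ) : Prop where
  norm_contact : ∀ j, ‖e j‖ = 1
  norm_vertex : ∀ j, ‖P j - β‖ = R
  tangent : ∀ j, e j * conj (P j) + conj (e j) * P j = 2 * r
  tangent_next : ∀ j, e j * conj (P (j + 1)) + conj (e j) * P (j + 1) = 2 * r
  ne_next : ∀ j, e j ≠ e (j + 1)
  ne_next_next : ∀ j, e j ≠ e (j + 1 + 1)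

/-- The same polygon traversed backwards; the first two sidelines are interchanged. -/
theorem IsTangentPolygon.reverse {β : ℂ} {R r : ℝ} {N : ℕ} {e P : ZMod N → ℂ}
    (h : IsTangentPolygon β R r e P) :
    IsTangentPolygon β R r (fun j => e (1 - j)) (fun j => P (1 - j + 1)) where
  norm_contact j := h.norm_contact _
  norm_vertex j := h.norm_vertex _
  tangent j := h.tangent_next _
  tangent_next j := by
    have := h.tangent (1 - j)
    rwa [show 1 - (j + 1) + 1 = 1 - j by ring]
  ne_next j := by
    have := h.ne_next (1 - (j + 1))
    rw [show 1 - (j + 1) + 1 = 1 - j by ring] at this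
    exact this.symm
  ne_next_next j := by
    have := h.ne_next_next (1 - (j + 1 + 1))
    rw [show 1 - (j + 1 + 1) + 1 + 1 = 1 - j by ring] at this
    exact this.symm

/-- The parameter `a` of the relation between points of tangency of consecutive sidelines, for the
circles of radius `R` about `β` and of radius `r` about `0`. -/
noncomputable def chainCenter (β : ℂ) (R r : ℝ) : ℂ := r * β / (Complex.normSq β - R ^ 2 : ℝ)
/-- The parameter `K` of the relation between points of tangency of consecutive sidelines, for the
circles of radius `R` about `β` and of radius `r` about `0`. -/
noncomputable def chainConst (β : ℂ) (R r : ℝ) : ℂ := 1 + 2 * r ^ 2 / (Complex.normSq β - R ^ 2 : ℝ)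

/-- The chain of points of tangency that starts with the two tangents from the point at angle `t` of
the circle of radius `R` about `β`. -/
noncomputable def ponceletChain (β : ℂ) (R r : ℝ) : ℕ → ℝ → ℂ :=
  contactChain (chainCenter β R r) (conj (chainCenter β R r))
    (fun t => contactRight r (circlePoint β R t)) (fun t => contactLeft r (circlePoint β R t))

section
variable {β : ℂ} {R r : ℝ} {N : ℕ} {e P : ZMod N → ℂ}

theorem IsTangentPolygon.contacts (hO : ∀ t, r ^ 2 < Complex.normSq (circlePoint β R t))
    (h : IsTangentPolygon β R r e P) (j : ZMod N) : ∃ t,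
    (e j = contactRight r (circlePoint β R t) ∧ e (j + 1) = contactLeft r (circlePoint β R t)) ∨
    (e j = contactLeft r (circlePoint β R t) ∧ e (j + 1) = contactRight r (circlePoint β R t)) := by
  obtain ⟨t, ht⟩ := exists_circlePoint_eq (h.norm_vertex (j + 1))
  refine ⟨t, ?_⟩
  have h1 := h.tangent_next j
  have h2 := h.tangent (j + 1)
  rw [← ht] at h1 h2
  have h3 := h.ne_next j
  rcases tangent_contact_cases (hO t) (h.norm_contact j) h1 with e1 | e1 <;>
    rcases tangent_contact_cases (hO t) (h.norm_contact (j + 1)) h2 with e2 | e2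
  · exact absurd (e1.trans e2.symm) h3
  · exact .inl ⟨e1, e2⟩
  · exact .inr ⟨e1, e2⟩
  · exact absurd (e1.trans e2.symm) h3

theorem IsTangentPolygon.rel (hr : 0 < r)
    (hO : ∀ t, r ^ 2 < Complex.normSq (circlePoint β R t)) (hB : Complex.normSq β - R ^ 2 ≠ 0)
    (h : IsTangentPolygon β R r e P) (j : ZMod N) :
    tangentRel (chainCenter β R r) (conj (chainCenter β R r)) (chainConst β R r)
      (e j) (e (j + 1)) = 0 := by
  obtain ⟨t, ⟨h1, h2⟩ | ⟨h1, h2⟩⟩ := h.contacts hO j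
  · rw [h1, h2]
    exact (isFlowPair_contacts hr hO hB).rel t
  · rw [h1, h2, tangentRel_comm]
    exact (isFlowPair_contacts hr hO hB).rel t

theorem chainConst_ne_one (hr : 0 < r) (hB : Complex.normSq β - R ^ 2 ≠ 0) :
    chainConst β R r ≠ 1 := by
  unfold chainConst
  rw [Ne, add_eq_left]
  exact div_ne_zero (mul_ne_zero two_ne_zero (pow_ne_zero 2 (Complex.ofReal_ne_zero.2 hr.ne')))
    (Complex.ofReal_ne_zero.2 hB)

theorem IsTangentPolygon.contactChain_eq (hr : 0 < r)
    (hO : ∀ t, r ^ 2 < Complex.normSq (circlePoint β R t)) (hB : Complex.normSq β - R ^ 2 ≠ 0)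
    (h : IsTangentPolygon β R r e P) {t : ℝ} (h0 : e 0 = contactRight r (circlePoint β R t))
    (h1 : e 1 = contactLeft r (circlePoint β R t)) (n : ℕ) :
    ponceletChain β R r n t = e n := by
  induction n using Nat.twoStepInduction with
  | zero => rw [Nat.cast_zero, h0]; rfl
  | one => rw [Nat.cast_one, h1]; rfl
  | more n ih1 ih2 =>
    have r1 := h.rel hr hO hB n
    have r2 := h.rel hr hO hB (n + 1)
    have n1 := ne_zero_of_norm_one (h.norm_contact n)
    have := eq_nextContact_of_ne n1 (ne_zero_of_norm_one (h.norm_contact (n + 1)))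
      (ne_zero_of_norm_one (h.norm_contact (n + 1 + 1)))
      (inv_sub_ne_zero_of_rel (h.norm_contact (n + 1)) (chainConst_ne_one hr hB) r1 n1) r1 r2
      (h.ne_next_next n)
    have step : ponceletChain β R r (n + 2) t = nextContact (chainCenter β R r)
      (conj (chainCenter β R r)) (ponceletChain β R r n t) (ponceletChain β R r (n + 1) t) := rfl
    rw [step, ih1, ih2, Nat.cast_succ, ← this, show n + 2 = n + 1 + 1 from rfl, Nat.cast_succ,
      Nat.cast_succ]

/-- Every tangent polygon, possibly traversed backwards, is a member of the one-parameter family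
`ponceletChain β R r`. -/
theorem IsTangentPolygon.exists_param [NeZero N] (hr : 0 < r)
    (hO : ∀ t, r ^ 2 < Complex.normSq (circlePoint β R t)) (hB : Complex.normSq β - R ^ 2 ≠ 0)
    (h : IsTangentPolygon β R r e P) (f : ℂ → ℂ) : ∃ t,
    ponceletChain β R r N t = contactRight r (circlePoint β R t) ∧
    ponceletChain β R r (N + 1) t = contactLeft r (circlePoint β R t) ∧
    ∑ j, f (e j) = ∑ j ∈ Finset.range N,
      f (ponceletChain β R r (j + 1) t) := by
  have key : ∀ {e P : ZMod N → ℂ}, IsTangentPolygon β R r e P → ∀ t,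
      e 0 = contactRight r (circlePoint β R t) → e 1 = contactLeft r (circlePoint β R t) →
      ponceletChain β R r N t = contactRight r (circlePoint β R t) ∧
      ponceletChain β R r (N + 1) t = contactLeft r (circlePoint β R t) ∧
      ∑ j, f (e j) = ∑ j ∈ Finset.range N,
        f (ponceletChain β R r (j + 1) t) := by
    intro e P h t h0 h1
    have hc := h.contactChain_eq hr hO hB h0 h1
    refine ⟨by rw [hc, ← h0]; simp, by rw [hc, ← h1]; simp, ?_⟩
    rw [← Equiv.sum_comp (Equiv.addRight (1 : ZMod N)), ZMod.sum_eq_sum_range]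
    refine Finset.sum_congr rfl fun j _ => ?_
    rw [hc]
    simp
  obtain ⟨t, ⟨h1, h2⟩ | ⟨h1, h2⟩⟩ := h.contacts hO 0
  · rw [zero_add] at h2
    exact ⟨t, key h t h1 h2⟩
  · rw [zero_add] at h2
    have := key h.reverse t (by simpa using h2) (by simpa using h1)
    exact ⟨t, this.1, this.2.1,
      (Equiv.sum_comp (Equiv.subLeft (1 : ZMod N)) (fun j => f (e j))).symm.trans this.2.2⟩

/-- The projection of the sum of the points of tangency to the line of centres is the same for all
tangent polygons. -/
theorem IsTangentPolygon.sum_eq [NeZero N] {e' P' : ZMod N → ℂ} (hr : 0 < r)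
    (hO : ∀ t, r ^ 2 < Complex.normSq (circlePoint β R t)) (hB : Complex.normSq β - R ^ 2 ≠ 0)
    (h : IsTangentPolygon β R r e P) (h' : IsTangentPolygon β R r e' P') :
    ∑ j, (conj (chainCenter β R r) * e j + chainCenter β R r / e j) =
    ∑ j, (conj (chainCenter β R r) * e' j + chainCenter β R r / e' j) := by
  obtain ⟨t, h1, h2, h3⟩ := h.exists_param hr hO hB
    (fun z => conj (chainCenter β R r) * z + chainCenter β R r / z)
  obtain ⟨t', -, -, h3'⟩ := h'.exists_param hr hO hB
    (fun z => conj (chainCenter β R r) * z + chainCenter β R r / z)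
  rw [h3, h3']
  obtain ⟨M, hM⟩ := exists_bound_of_outside hr hO
  exact (isFlowPair_contacts hr hO hB).sum_eq_of_closed hM (chainConst_ne_one hr hB) h1 h2 t t'

/-- The sum of the cosines of the angles between consecutive normals is the same for all tangent
polygons, since each cosine is affine in the projections of the two points of tangency. -/
theorem IsTangentPolygon.sum_gap_eq [NeZero N] {e' P' : ZMod N → ℂ} (hr : 0 < r)
    (hO : ∀ t, r ^ 2 < Complex.normSq (circlePoint β R t)) (hB : Complex.normSq β - R ^ 2 ≠ 0)
    (h : IsTangentPolygon β R r e P) (h' : IsTangentPolygon β R r e' P') :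
    ∑ j, (e j / e (j + 1) + e (j + 1) / e j) = ∑ j, (e' j / e' (j + 1) + e' (j + 1) / e' j) := by
  have key : ∀ {e P : ZMod N → ℂ}, IsTangentPolygon β R r e P →
      ∑ j, (e j / e (j + 1) + e (j + 1) / e j) =
        4 * ∑ j, (conj (chainCenter β R r) * e j + chainCenter β R r / e j)
          - ∑ _j : ZMod N, 2 * chainConst β R r := by
    intro e P h
    have e1 : ∑ j, (conj (chainCenter β R r) * e (j + 1) + chainCenter β R r / e (j + 1)) =
        ∑ j, (conj (chainCenter β R r) * e j + chainCenter β R r / e j) :=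
      Equiv.sum_comp (Equiv.addRight (1 : ZMod N)) (fun j =>
        conj (chainCenter β R r) * e j + chainCenter β R r / e j)
    rw [show ∀ x : ℂ, 4 * x = 2 * x + 2 * x by intro x; ring]
    nth_rw 2 [← e1]
    rw [Finset.mul_sum, Finset.mul_sum, ← Finset.sum_add_distrib, ← Finset.sum_sub_distrib]
    refine Finset.sum_congr rfl fun j _ => ?_
    have := h.rel hr hO hB j
    unfold tangentRel at this
    linear_combination this
  rw [key h, key h', h.sum_eq hr hO hB h']
end

/-! ### Limiting points -/

/-- If the equation of the inverse of a circle holds at all points of a circle about `o`, with the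
possible exception of the centre of inversion `l`, then it is a multiple of the equation of the
latter circle. The difference of the two equations is affine, and it vanishes at three of the points
`o ± (R, 0)`, `o ± (0, R)`, hence also at the fourth. -/
theorem inversion_equation_eq {o₀ o₁ l₀ l₁ d₀ d₁ α R : ℝ} (hR : 0 < R)
    (hg : ∀ a b : ℝ, (a - o₀) ^ 2 + (b - o₁) ^ 2 = R ^ 2 → (a ≠ l₀ ∨ b ≠ l₁) →
      1 - 2 * ((a - l₀) * d₀ + (b - l₁) * d₁) + α * ((a - l₀) ^ 2 + (b - l₁) ^ 2) = 0)
    (a b : ℝ) :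
    1 - 2 * ((a - l₀) * d₀ + (b - l₁) * d₁) + α * ((a - l₀) ^ 2 + (b - l₁) ^ 2) =
      α * ((a - o₀) ^ 2 + (b - o₁) ^ 2 - R ^ 2) := by
  have h1 := hg (o₀ + R) o₁ (by ring)
  have h2 := hg (o₀ - R) o₁ (by ring)
  have h3 := hg o₀ (o₁ + R) (by ring)
  have h4 := hg o₀ (o₁ - R) (by ring)
  have key : (1 - 2 * ((o₀ + R - l₀) * d₀ + (o₁ - l₁) * d₁) +
        α * ((o₀ + R - l₀) ^ 2 + (o₁ - l₁) ^ 2) = 0 ∧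
      1 - 2 * ((o₀ - R - l₀) * d₀ + (o₁ - l₁) * d₁) +
        α * ((o₀ - R - l₀) ^ 2 + (o₁ - l₁) ^ 2) = 0) ∧
      1 - 2 * ((o₀ - l₀) * d₀ + (o₁ + R - l₁) * d₁) +
        α * ((o₀ - l₀) ^ 2 + (o₁ + R - l₁) ^ 2) = 0 ∧
      1 - 2 * ((o₀ - l₀) * d₀ + (o₁ - R - l₁) * d₁) +
        α * ((o₀ - l₀) ^ 2 + (o₁ - R - l₁) ^ 2) = 0 := by
    by_cases e0 : o₀ = l₀
    · have h1' := h1 (.inl (by linarith))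
      have h2' := h2 (.inl (by linarith))
      refine ⟨⟨h1', h2'⟩, ?_⟩
      by_cases e1 : o₁ + R = l₁
      · have h4' := h4 (.inr (by linarith))
        exact ⟨by linear_combination h1' + h2' - h4', h4'⟩
      · have h3' := h3 (.inr e1)
        exact ⟨h3', by linear_combination h1' + h2' - h3'⟩
    · have h3' := h3 (.inl e0)
      have h4' := h4 (.inl e0)
      refine ⟨?_, h3', h4'⟩
      by_cases e1 : o₀ + R = l₀
      · have h2' := h2 (.inl (by linarith))
        exact ⟨by linear_combination h3' + h4' - h2', h2'⟩
      · have h1' := h1 (.inl e1)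
        exact ⟨h1', by linear_combination h3' + h4' - h1'⟩
  obtain ⟨⟨k1, k2⟩, k3, k4⟩ := key
  have hR' := hR.ne'
  have c0 : α * (o₀ - l₀) = d₀ := by
    have : (4 * R) * (α * (o₀ - l₀) - d₀) = 0 := by linear_combination k1 - k2
    have := (mul_eq_zero.1 this).resolve_left (by positivity)
    linear_combination this
  have c1 : α * (o₁ - l₁) = d₁ := by
    have : (4 * R) * (α * (o₁ - l₁) - d₁) = 0 := by linear_combination k3 - k4
    have := (mul_eq_zero.1 this).resolve_left (by positivity)
    linear_combination this
  linear_combination (k1 + k2) / 2 + 2 * (a - o₀) * c0 + 2 * (b - o₁) * c1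

theorem Plane.dist_sq_eq (x y : Plane) : dist x y ^ 2 = (x 0 - y 0) ^ 2 + (x 1 - y 1) ^ 2 := by
  rw [EuclideanSpace.dist_eq, Real.sq_sqrt (Finset.sum_nonneg fun _ _ => sq_nonneg _),
    Fin.sum_univ_two, Real.dist_eq, Real.dist_eq, sq_abs, sq_abs]

/-- The equation in `x` that says that the inverse of `x` lies on the sphere of radius `ρ` about `c`
is a multiple of the equation of `S`. -/
theorem inversion_equation_of_subset {S : EuclideanGeometry.Sphere Plane} (hS : 0 < S.radius)
    {ℓ c : Plane} {ρ : ℝ}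
    (h : EuclideanGeometry.inversion ℓ 1 '' (S : Set Plane) ⊆ Metric.sphere c ρ) (x : Plane) :
    1 - 2 * ((x 0 - ℓ 0) * (c 0 - ℓ 0) + (x 1 - ℓ 1) * (c 1 - ℓ 1)) +
        (dist c ℓ ^ 2 - ρ ^ 2) * dist x ℓ ^ 2 =
      (dist c ℓ ^ 2 - ρ ^ 2) * (dist x S.center ^ 2 - S.radius ^ 2) := by
  rw [Plane.dist_sq_eq x, Plane.dist_sq_eq x]
  refine inversion_equation_eq hS (fun a b hab hne => ?_) (x 0) (x 1)
  have hy : (!₂[a, b] : Plane) ∈ (S : Set Plane) := by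
    show dist _ _ = _
    rw [← sq_eq_sq₀ dist_nonneg hS.le, Plane.dist_sq_eq]
    exact hab
  have hd : dist (!₂[a, b] : Plane) ℓ ^ 2 = (a - ℓ 0) ^ 2 + (b - ℓ 1) ^ 2 := Plane.dist_sq_eq _ _
  have hd0 : (a - ℓ 0) ^ 2 + (b - ℓ 1) ^ 2 ≠ 0 := by
    rcases hne with h | h
    · have := pow_pos (abs_pos.2 (sub_ne_zero.2 h)) 2
      rw [sq_abs] at this
      positivity
    · have := pow_pos (abs_pos.2 (sub_ne_zero.2 h)) 2
      rw [sq_abs] at this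
      positivity
  have hi := h ⟨_, hy, rfl⟩
  rw [mem_sphere_iff_norm, ← dist_eq_norm] at hi
  have hi2 := congrArg (· ^ 2) hi
  simp only [Plane.dist_sq_eq, EuclideanGeometry.inversion, vsub_eq_sub, vadd_eq_add, div_pow, hd,
    PiLp.add_apply, PiLp.smul_apply, PiLp.sub_apply, smul_eq_mul, one_pow] at hi2
  rw [Plane.dist_sq_eq c, ← hi2]
  simp only [Matrix.cons_val_zero, Matrix.cons_val_one]
  field_simp
  ring

/-- On `C` the square of the distance to a limiting point is a constant multiple of the power with
respect to `D`: the limiting point is a point circle of the pencil spanned by `C` and `D`. -/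
theorem IsLimitingPoint.exists_dist_sq_eq {C D : EuclideanGeometry.Sphere Plane}
    (hC : 0 < C.radius) (hD : 0 < D.radius) (hCD : Disjoint (C : Set Plane) (D : Set Plane))
    {ℓ : Plane} (hℓ : IsLimitingPoint C D ℓ) :
    ∃ k : ℝ, ∀ x ∈ C, dist x ℓ ^ 2 = k * (dist x D.center ^ 2 - D.radius ^ 2) := by
  obtain ⟨c, ρ₁, ρ₂, -, -, h1, h2⟩ := hℓ
  have e1 := inversion_equation_of_subset hC h1.subset
  have e2 := inversion_equation_of_subset hD h2.subset
  have key : ∀ x ∈ C, (ρ₁ ^ 2 - ρ₂ ^ 2) * dist x ℓ ^ 2 =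
      (dist c ℓ ^ 2 - ρ₂ ^ 2) * (dist x D.center ^ 2 - D.radius ^ 2) := by
    intro x hx
    have f1 := e1 x
    rw [EuclideanGeometry.mem_sphere.1 hx] at f1
    linear_combination e2 x - f1
  -- If the radii agreed, every point of `C` would lie on `D`, or the inversion equation of `D`
  -- would vanish identically, although its value at `ℓ` is `1`.
  have hne : ρ₁ ^ 2 - ρ₂ ^ 2 ≠ 0 := by
    intro h0
    have hx : (!₂[C.center 0 + C.radius, C.center 1] : Plane) ∈ C := by
      rw [EuclideanGeometry.mem_sphere, ← sq_eq_sq₀ dist_nonneg hC.le, Plane.dist_sq_eq]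
      simp
    have hk := key _ hx
    rw [h0, zero_mul] at hk
    rcases mul_eq_zero.1 hk.symm with h | h
    · have := e2 ℓ
      rw [h] at this
      simp at this
    · refine Set.disjoint_left.1 hCD hx ?_
      show dist _ _ = _
      rw [← sq_eq_sq₀ dist_nonneg hD.le]
      linear_combination h
  refine ⟨(dist c ℓ ^ 2 - ρ₂ ^ 2) / (ρ₁ ^ 2 - ρ₂ ^ 2), fun x hx => ?_⟩
  have := key x hx
  field_simp
  linear_combination this

/-! ### Pedal polygons -/

/-- A point of the plane as a complex number. -/
noncomputable def Plane.toComplex (x : Plane) : ℂ := ⟨x 0, x 1⟩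

theorem Plane.toComplex_injective : Function.Injective Plane.toComplex := by
  intro x y h
  ext i
  fin_cases i
  · exact congrArg Complex.re h
  · exact congrArg Complex.im h

theorem Plane.normSq_toComplex_sub (x y : Plane) :
    Complex.normSq (x.toComplex - y.toComplex) = dist x y ^ 2 := by
  rw [Plane.dist_sq_eq, Complex.normSq_apply]
  simp only [Plane.toComplex, Complex.sub_re, Complex.sub_im]
  ring

theorem mul_conj_add_conj_mul (e p : ℂ) :
    e * conj p + conj e * p = 2 * ((e.re * p.re + e.im * p.im : ℝ) : ℂ) := by
  apply Complex.ext <;> simp <;> ring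

theorem eq_neg_of_two_lines {e e' w : ℂ} (he : ‖e‖ = 1) (he' : ‖e'‖ = 1) (hne : e ≠ e')
    (hw : w ≠ 0) (h : e * conj w + conj e * w = 0) (h' : e' * conj w + conj e' * w = 0) :
    e' = -e := by
  have h0 := ne_zero_of_norm_one he
  have h0' := ne_zero_of_norm_one he'
  rw [conj_of_norm_one he] at h
  rw [conj_of_norm_one he'] at h'
  field_simp at h h'
  have : w * (e - e') * (e + e') = 0 := by linear_combination e ^ 2 * h' - e' ^ 2 * h
  have := (mul_eq_zero.1 this).resolve_left (mul_ne_zero hw (sub_ne_zero.2 hne))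
  linear_combination this

theorem line_circle_not_three {e x y z β : ℂ} {r R : ℝ} (he : ‖e‖ = 1)
    (hx : e * conj x + conj e * x = 2 * r) (hy : e * conj y + conj e * y = 2 * r)
    (hz : e * conj z + conj e * z = 2 * r) (hx' : ‖x - β‖ = R) (hy' : ‖y - β‖ = R)
    (hz' : ‖z - β‖ = R) (hxy : x ≠ y) (hyz : y ≠ z) : x = z := by
  have h0 := ne_zero_of_norm_one he
  have hn : ∀ w : ℂ, ‖w - β‖ = R → (w - β) * (conj w - conj β) = R ^ 2 := by
    intro w hw
    rw [← map_sub, Complex.mul_conj, Complex.normSq_eq_norm_sq, hw]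
    push_cast; rfl
  have k : ∀ w : ℂ, e * conj w + conj e * w = 2 * r → ‖w - β‖ = R →
      (w - β) * (2 * r - conj e * w - e * conj β) = e * R ^ 2 := by
    intro w h1 h2
    rw [← hn w h2, ← h1]; ring
  have a1 : 2 * r + conj e * β - e * conj β - conj e * (x + y) = 0 := by
    apply mul_left_cancel₀ (sub_ne_zero.2 hxy)
    linear_combination k x hx hx' - k y hy hy'
  have a2 : 2 * r + conj e * β - e * conj β - conj e * (y + z) = 0 := by
    apply mul_left_cancel₀ (sub_ne_zero.2 hyz)
    linear_combination k y hy hy' - k z hz hz'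
  apply mul_left_cancel₀ ((map_ne_zero (starRingEnd ℂ)).2 h0)
  linear_combination a2 - a1

/-- The squared distance between the feet of the perpendiculars from `(l, m)` to two tangents of the
circle of radius `r` about `0`, with normals `(a, b)` and `(c, d)`, that meet at `(x, y)`. -/
theorem pedal_dist_sq_eq {a b c d x y l m r k : ℝ} (he : a ^ 2 + b ^ 2 = 1)
    (he' : c ^ 2 + d ^ 2 = 1) (hne : a * c + b * d ≠ 1) (h1 : a * x + b * y = r)
    (h2 : c * x + d * y = r)
    (hk : (x - l) ^ 2 + (y - m) ^ 2 = k * (x ^ 2 + y ^ 2 - r ^ 2)) :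
    ((r - (a * l + b * m)) * a - (r - (c * l + d * m)) * c) ^ 2 +
      ((r - (a * l + b * m)) * b - (r - (c * l + d * m)) * d) ^ 2 =
    k * (r * (1 - (a * c + b * d))) ^ 2 := by
  -- The Gram determinant of three vectors in the plane vanishes.
  have gram : ∀ s t : ℝ, (s ^ 2 + t ^ 2) * (1 - (a * c + b * d) ^ 2) =
      (a * s + b * t) ^ 2 + (c * s + d * t) ^ 2
        - 2 * (a * s + b * t) * (c * s + d * t) * (a * c + b * d) := by
    intro s t
    linear_combination -(s ^ 2 + t ^ 2) * ((c ^ 2 + d ^ 2) * he + he') +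
      (a * s + b * t) ^ 2 * he' + (c * s + d * t) ^ 2 * he
  have hp : (x ^ 2 + y ^ 2) * (1 + (a * c + b * d)) = 2 * r ^ 2 := by
    apply mul_left_cancel₀ (sub_ne_zero.2 hne.symm)
    have := gram x y
    rw [h1, h2] at this
    linear_combination this
  have g1 : r - (a * l + b * m) = a * (x - l) + b * (y - m) := by linear_combination -h1
  have g2 : r - (c * l + d * m) = c * (x - l) + d * (y - m) := by linear_combination -h2
  rw [g1, g2]
  have g := gram (x - l) (y - m)
  rw [hk] at g
  linear_combination -g + k * (1 - (a * c + b * d)) * hp +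
    (a * (x - l) + b * (y - m)) ^ 2 * he + (c * (x - l) + d * (y - m)) ^ 2 * he'

section
open EuclideanGeometry
variable {C D : Sphere Plane} {N : ℕ} {p : ZMod N → Plane}

theorem exists_unit_normal_of_isTangent (hD : 0 < D.radius) {s : AffineSubspace ℝ Plane}
    (h : D.IsTangent s) : ∃ e : ℂ, ‖e‖ = 1 ∧ ∀ x ∈ s,
      e.re * (x 0 - D.center 0) + e.im * (x 1 - D.center 1) = D.radius := by
  obtain ⟨q, hq⟩ := h
  have hq1 := mem_sphere.1 hq.mem_sphere
  have hq2 : (q 0 - D.center 0) ^ 2 + (q 1 - D.center 1) ^ 2 = D.radius ^ 2 := by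
    rw [← Plane.dist_sq_eq, hq1]
  refine ⟨⟨(q 0 - D.center 0) / D.radius, (q 1 - D.center 1) / D.radius⟩, ?_, fun x hx => ?_⟩
  · rw [Complex.norm_def, Complex.normSq_mk, Real.sqrt_eq_one]
    field_simp
    linear_combination hq2
  · have := hq.inner_left_eq_zero_of_mem hx
    simp only [EuclideanSpace.inner_eq_star_dotProduct, vsub_eq_sub] at this
    simp [dotProduct, Fin.sum_univ_two] at this
    field_simp
    linear_combination this + hq2

/-- The foot of the perpendicular from `ℓ` to a line with unit normal `e` at signed distance `s`
from `O`. -/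
theorem orthogonalProjection_eq_add_normal {x y : Plane} {e : ℂ} {s : ℝ} (hxy : x ≠ y)
    (O ℓ : Plane) (he : ‖e‖ = 1)
    (h : ∀ w ∈ affineSpan ℝ {x, y}, e.re * (w 0 - O 0) + e.im * (w 1 - O 1) = s) :
    (orthogonalProjection (affineSpan ℝ {x, y}) ℓ : Plane).toComplex = ℓ.toComplex +
      ((s - (e.re * (ℓ 0 - O 0) + e.im * (ℓ 1 - O 1)) : ℝ) : ℂ) * e := by
  have hx := left_mem_affineSpan_pair ℝ x y
  have hy := right_mem_affineSpan_pair ℝ x y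
  have hq := h _ (orthogonalProjection_mem (s := affineSpan ℝ {x, y}) ℓ)
  have hperp := Submodule.inner_right_of_mem_orthogonal
    (AffineSubspace.vsub_mem_direction hy hx)
    (vsub_orthogonalProjection_mem_direction_orthogonal (affineSpan ℝ {x, y}) ℓ)
  generalize (orthogonalProjection (affineSpan ℝ {x, y}) ℓ : Plane) = q at *
  simp only [EuclideanSpace.inner_eq_star_dotProduct, vsub_eq_sub] at hperp
  simp [dotProduct, Fin.sum_univ_two] at hperp
  have hex := h x hx
  have hey := h y hy
  have he2 : e.re ^ 2 + e.im ^ 2 = 1 := by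
    have := Complex.normSq_eq_norm_sq e
    rw [he, Complex.normSq_apply] at this
    linear_combination this
  have hτ : e.re * (y 1 - x 1) - e.im * (y 0 - x 0) ≠ 0 := by
    intro h0
    apply hxy
    ext i
    fin_cases i
    · show x 0 = y 0
      linear_combination (y 0 - x 0) * he2 - e.re * (hey - hex) + e.im * h0
    · show x 1 = y 1
      linear_combination (y 1 - x 1) * he2 - e.im * (hey - hex) - e.re * h0
  have hpar : e.re * (ℓ 1 - q 1) - e.im * (ℓ 0 - q 0) = 0 := by
    apply mul_left_cancel₀ hτ
    linear_combination hperp - (e.re * (ℓ 0 - q 0) + e.im * (ℓ 1 - q 1)) * (hey - hex)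
      + ((y 0 - x 0) * (ℓ 0 - q 0) + (y 1 - x 1) * (ℓ 1 - q 1)) * (he2)
  apply Complex.ext
  · simp only [Plane.toComplex, Complex.add_re, Complex.re_ofReal_mul]
    linear_combination e.re * hq + e.im * hpar - (q 0 - ℓ 0) * he2
  · simp only [Plane.toComplex, Complex.add_im, Complex.im_ofReal_mul]
    linear_combination e.im * hq - e.re * hpar - (q 1 - ℓ 1) * he2

theorem IsPonceletPolygon.exists_tangentPolygon (hD : 0 < D.radius)
    (h : IsPonceletPolygon C D p) : ∃ e : ZMod N → ℂ,
    IsTangentPolygon (C.center.toComplex - D.center.toComplex) C.radius D.radius e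
      (fun j => (p j).toComplex - D.center.toComplex) ∧
    ∀ j, ∀ x ∈ affineSpan ℝ {p j, p (j + 1)},
      (e j).re * (x 0 - D.center 0) + (e j).im * (x 1 - D.center 1) = D.radius := by
  choose e he hline using fun j => exists_unit_normal_of_isTangent hD (h.tangent j)
  refine ⟨e, ?_, hline⟩
  have hD0 : (D.radius : ℂ) ≠ 0 := Complex.ofReal_ne_zero.2 hD.ne'
  have htan : ∀ j, ∀ x ∈ affineSpan ℝ {p j, p (j + 1)},
      e j * conj (x.toComplex - D.center.toComplex)
        + conj (e j) * (x.toComplex - D.center.toComplex) = 2 * D.radius := by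
    intro j x hx
    rw [mul_conj_add_conj_mul, ← hline j x hx]
    simp [Plane.toComplex]
  have t1 := fun j => htan j _ (left_mem_affineSpan_pair ℝ (p j) (p (j + 1)))
  have t2 := fun j => htan j _ (right_mem_affineSpan_pair ℝ (p j) (p (j + 1)))
  have hinj : ∀ {j k}, p j ≠ p k →
      (p j).toComplex - D.center.toComplex ≠ (p k).toComplex - D.center.toComplex :=
    fun hne h0 => hne (Plane.toComplex_injective (sub_left_injective h0))
  have hnorm : ∀ j, ‖(p j).toComplex - D.center.toComplex
      - (C.center.toComplex - D.center.toComplex)‖ = C.radius := by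
    intro j
    rw [sub_sub_sub_cancel_right, Complex.norm_def, Plane.normSq_toComplex_sub,
      EuclideanGeometry.mem_sphere.1 (h.mem_circle j),
      Real.sqrt_sq (EuclideanGeometry.mem_sphere.1 (h.mem_circle j) ▸ dist_nonneg)]
  -- Three consecutive vertices on one sideline would be three points of `C` on a line.
  have hne : ∀ j, e j ≠ e (j + 1) := by
    intro j h0
    have k2 := t2 (j + 1)
    rw [← h0] at k2
    refine hinj (h.prev_ne_next (j + 1)) ?_
    rw [add_sub_cancel_right]
    exact line_circle_not_three (he j) (t1 j) (t2 j) k2 (hnorm _) (hnorm _) (hnorm _)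
      (hinj (h.ne_next j)) (hinj (h.ne_next (j + 1)))
  refine ⟨he, hnorm, t1, t2, hne, fun j h0 => ?_⟩
  have k1 := t1 (j + 1 + 1)
  rw [← h0] at k1
  -- If `e j = e (j + 2)`, two different vertices lie on the sidelines `j` and `j + 1`, which are
  -- then parallel tangents.
  have hw := sub_ne_zero.2 (hinj (h.ne_next (j + 1)))
  have := eq_neg_of_two_lines (he j) (he (j + 1)) (hne j) hw
    (by rw [map_sub]; linear_combination t2 j - k1)
    (by rw [map_sub]; linear_combination t1 (j + 1) - t2 (j + 1))
  have k3 := t1 (j + 1)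
  rw [this, map_neg] at k3
  apply hD0
  linear_combination -(t2 j + k3) / 4

/-- The sides of the pedal polygon with respect to a limiting point, in terms of the cosine of the
angle between the normals of two sidelines. -/
theorem dist_pedalPolygon (h : IsPonceletPolygon C D p) {e : ZMod N → ℂ}
    (he : IsTangentPolygon (C.center.toComplex - D.center.toComplex) C.radius D.radius e
      (fun j => (p j).toComplex - D.center.toComplex))
    (hline : ∀ j, ∀ x ∈ affineSpan ℝ {p j, p (j + 1)},
      (e j).re * (x 0 - D.center 0) + (e j).im * (x 1 - D.center 1) = D.radius)
    (hD : 0 < D.radius) {ℓ : Plane} {k : ℝ}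
    (hk : ∀ x ∈ C, dist x ℓ ^ 2 = k * (dist x D.center ^ 2 - D.radius ^ 2)) (j : ZMod N) :
    dist (pedalPolygon p ℓ j) (pedalPolygon p ℓ (j + 1)) =
      √k * D.radius * (1 - (e j / e (j + 1) + e (j + 1) / e j).re / 2) := by
  have hunit : ∀ j, (e j).re ^ 2 + (e j).im ^ 2 = 1 := by
    intro j
    have := Complex.normSq_eq_norm_sq (e j)
    rw [he.norm_contact, Complex.normSq_apply] at this
    linear_combination this
  have hγ : (e j / e (j + 1) + e (j + 1) / e j).re / 2 =
      (e j).re * (e (j + 1)).re + (e j).im * (e (j + 1)).im := by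
    rw [div_eq_mul_inv (e j), div_eq_mul_inv (e (j + 1)), ← conj_of_norm_one (he.norm_contact j),
      ← conj_of_norm_one (he.norm_contact (j + 1))]
    simp
    ring
  have hsq : ((e j).re - (e (j + 1)).re) ^ 2 + ((e j).im - (e (j + 1)).im) ^ 2 =
      2 * (1 - ((e j).re * (e (j + 1)).re + (e j).im * (e (j + 1)).im)) := by
    linear_combination hunit j + hunit (j + 1)
  have hγ1 : (e j).re * (e (j + 1)).re + (e j).im * (e (j + 1)).im ≤ 1 := by
    nlinarith [sq_nonneg ((e j).re - (e (j + 1)).re), sq_nonneg ((e j).im - (e (j + 1)).im)]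
  have hγne : (e j).re * (e (j + 1)).re + (e j).im * (e (j + 1)).im ≠ 1 := by
    intro h1
    rw [h1] at hsq
    apply he.ne_next j
    apply Complex.ext
    · nlinarith [sq_nonneg ((e j).re - (e (j + 1)).re), sq_nonneg ((e j).im - (e (j + 1)).im)]
    · nlinarith [sq_nonneg ((e j).re - (e (j + 1)).re), sq_nonneg ((e j).im - (e (j + 1)).im)]
  have hkp := hk _ (h.mem_circle (j + 1))
  rw [Plane.dist_sq_eq, Plane.dist_sq_eq] at hkp
  have l1 := hline j _ (right_mem_affineSpan_pair ℝ (p j) (p (j + 1)))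
  have l2 := hline (j + 1) _ (left_mem_affineSpan_pair ℝ (p (j + 1)) (p (j + 1 + 1)))
  have main := pedal_dist_sq_eq (l := ℓ 0 - D.center 0) (m := ℓ 1 - D.center 1) (k := k)
    (hunit j) (hunit (j + 1)) hγne l1 l2 (by rw [← hkp]; ring)
  have q1 := orthogonalProjection_eq_add_normal (h.ne_next j) D.center ℓ (he.norm_contact j)
    (hline j)
  have q2 := orthogonalProjection_eq_add_normal (h.ne_next (j + 1)) D.center ℓ
    (he.norm_contact (j + 1)) (hline (j + 1))
  have hd : dist (pedalPolygon p ℓ j) (pedalPolygon p ℓ (j + 1)) ^ 2 = k * (D.radius *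
      (1 - ((e j).re * (e (j + 1)).re + (e j).im * (e (j + 1)).im))) ^ 2 := by
    rw [← main, ← Plane.normSq_toComplex_sub, pedalPolygon, pedalPolygon, q1, q2,
      Complex.normSq_apply]
    simp only [Complex.sub_re, Complex.sub_im, Complex.add_re, Complex.add_im,
      Complex.re_ofReal_mul, Complex.im_ofReal_mul]
    ring
  rw [hγ, ← Real.sqrt_sq (dist_nonneg (x := pedalPolygon p ℓ j)), hd,
    Real.sqrt_mul' _ (sq_nonneg _), Real.sqrt_sq (mul_nonneg hD.le (by linarith)), mul_assoc]
end

theorem theorem2 (C D : EuclideanGeometry.Sphere Plane)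
    (hC : 0 < C.radius) (hD : 0 < D.radius)
    (hCD : Disjoint (C : Set Plane) (D : Set Plane))
    (ℓ : Plane) (hℓ : IsLimitingPoint C D ℓ)
    (N : ℕ) [NeZero N] (hN : 3 ≤ N) :
    ∃ L : ℝ, ∀ p : ZMod N → Plane, IsPonceletPolygon C D p →
      polygonPerimeter (pedalPolygon p ℓ) = L := by
  obtain ⟨k, hk⟩ := hℓ.exists_dist_sq_eq hC hD hCD
  by_cases hex : ∃ p : ZMod N → Plane, IsPonceletPolygon C D p
  swap
  · exact ⟨0, fun p hp => absurd ⟨p, hp⟩ hex⟩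
  obtain ⟨p₀, h₀⟩ := hex
  obtain ⟨e₀, he₀, -⟩ := h₀.exists_tangentPolygon hD
  set β := C.center.toComplex - D.center.toComplex with hβ
  have hdis : ∀ t, Complex.normSq (circlePoint β C.radius t) ≠ D.radius ^ 2 := by
    intro t ht
    have hn := norm_circlePoint_sub (β := β) hC t
    set z := circlePoint β C.radius t + D.center.toComplex with hz
    have hx : Plane.toComplex !₂[z.re, z.im] = z := rfl
    refine Set.disjoint_left.1 hCD (?_ : (!₂[z.re, z.im] : Plane) ∈ (C : Set Plane)) ?_
    · show dist _ _ = _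
      rw [← sq_eq_sq₀ dist_nonneg hC.le, ← Plane.normSq_toComplex_sub, hx,
        Complex.normSq_eq_norm_sq, ← hn, hz, hβ]
      congr 2
      ring
    · show dist _ _ = _
      rw [← sq_eq_sq₀ dist_nonneg hD.le, ← Plane.normSq_toComplex_sub, hx, hz,
        add_sub_cancel_right, ht]
  -- A sideline through a vertex is tangent to `D`, so that vertex is not inside `D`.
  have hO : ∀ t, D.radius ^ 2 < Complex.normSq (circlePoint β C.radius t) := by
    obtain ⟨t₁, ht₁⟩ := exists_circlePoint_eq (he₀.norm_vertex 0)
    refine outside_of_disjoint hdis (t₁ := t₁) ?_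
    rw [ht₁, Plane.normSq_toComplex_sub]
    have := (h₀.tangent 0).radius_le_dist_center (left_mem_affineSpan_pair ℝ (p₀ 0) (p₀ (0 + 1)))
    exact pow_le_pow_left₀ hD.le this 2
  have hB := power_ne_zero_of_outside hC hO
  refine ⟨∑ j, √k * D.radius * (1 - (e₀ j / e₀ (j + 1) + e₀ (j + 1) / e₀ j).re / 2),
    fun p hp => ?_⟩
  obtain ⟨e, he, hline⟩ := hp.exists_tangentPolygon hD
  have hs := congrArg Complex.re (he.sum_gap_eq hD hO hB he₀)
  rw [Complex.re_sum, Complex.re_sum] at hs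
  unfold polygonPerimeter
  rw [Finset.sum_congr rfl fun j _ => dist_pedalPolygon hp he hline hD hk j, ← Finset.mul_sum,
    ← Finset.mul_sum, Finset.sum_sub_distrib, Finset.sum_sub_distrib, ← Finset.sum_div,
    ← Finset.sum_div, hs]
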